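/- Let $n$ be a positive integer and let $a=(a_{i,j})_{1\le i,j\le n}$ be real numbers such that $\sum_{k=1}^n a_{i,k}=0$ for every $i$, $\sum_{k=1}^n a_{k,j}=0$ for every $j$, and $\frac{1}{n-1}\sum_{i,j=1}^n a_{i,j}^2=1$ (so that $n\ge 2$). Let $\pi$ be a uniformly distributed random permutation of $\{1,\dots,n\}$, let $W=\sum_{i=1}^n a_{i,\pi(i)}$, and let $\|a\|=\sup_{1\le i,j\le n}|a_{i,j}|$. Then $$d_{\mathrm K}\bigl(\mathscr L(W),\mathrm N(0,1)\bigr)\le 448\,n\,\|a\|^3+96\,\|a\|,$$ where $\mathscr L(W)$ is the law of $W$ and $d_{\mathrm K}(P,Q)=\sup_{x\in\mathbb R}|P((-\infty,x])-Q((-\infty,x])|$ is the Kolmogorov distance between probability measures on $\mathbb R$. -/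

import Mathlib

open MeasureTheory ProbabilityTheory

noncomputable section

/-- The Kolmogorov distance `sup_x |F_P(x) - F_Q(x)|` between two probability measures on the
real line, where `F_P`, `F_Q` are their distribution functions. -/
def kolmogorovDist (P Q : Measure ℝ) : ℝ :=
  ⨆ x : ℝ, |cdf P x - cdf Q x|

/-- `π` is a uniformly distributed random permutation of `{1, …, n}`: it is measurable and takes
each of the `n!` permutations with probability `1 / n!`. -/
def IsUniformPermutation {Ω : Type*} [MeasurableSpace Ω] {n : ℕ}
    (π : Ω → Equiv.Perm (Fin n)) (μ : Measure Ω) : Prop :=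
  ∀ σ : Equiv.Perm (Fin n),
    MeasurableSet (π ⁻¹' {σ}) ∧ μ (π ⁻¹' {σ}) = ((n.factorial : ℕ) : ENNReal)⁻¹

/-- The combinatorial statistic `W = ∑ i, a i (π i)`. -/
def hoeffdingStat {Ω : Type*} {n : ℕ} (a : Fin n → Fin n → ℝ)
    (π : Ω → Equiv.Perm (Fin n)) (ω : Ω) : ℝ :=
  ∑ i, a i (π ω i)

/-- The norm `‖a‖ = sup_{i,j} |a i j|` of an array. -/
def arraySupNorm {n : ℕ} (a : Fin n → Fin n → ℝ) : ℝ :=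
  ⨆ i : Fin n, ⨆ j : Fin n, |a i j|

end

/-!
The bound follows from Stein's method with a bounded zero-bias coupling, which gives the stronger
estimate `84 * ‖a‖`; the cubic term is then added for free, being nonnegative.

Suppose that `W` and `W*` live on the same probability space, that `E [W f(W)] = E [f'(W*)]` for all
continuously differentiable `f`, and that `|W* - W| ≤ δ`. For continuous `h : ℝ → [0, 1]` with
standard normal mean `m`, the solution `f` of `f' w - w * f w = h w - m` satisfies `|f| ≤ 3`,
`|w * f w| ≤ 1` and hence `|f'| ≤ 2` (`exists_stein_solution`). Therefore
`E h(W*) - m = E [W f(W) - W* f(W*)]`, and `E |W| ≤ 1` bounds this by `5 * δ`. No derivative of `h`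
enters, so `h` may be a steep ramp; comparing the indicator of `W ≤ z` with ramps at `W*` shifted
by `δ`, and using that the normal density is at most `1`, gives a Kolmogorov distance of at most
`7 * δ` (`abs_sub_cdf_gaussian_le_of_zeroBias`).

For `W = ∑ i, a i (σ i)`, exchanging the values at random positions `i`, `j` produces an
exchangeable pair whose increment `swapDiff a i j (σ i) (σ j)` depends only on the two positions and
their values `k`, `l`. Writing the increment of `f` as an integral of `f'` turns the
exchangeable-pair identity into a zero-bias identity (`sum_permSum_mul_eq_zeroBias`): draw
`(i, j, k, l)` with probability proportional to `swapDiff a i j k l ^ 2`, then a uniform permutation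
with `σ i = k` and `σ j = l`, and let `W*` be uniform on the segment between the statistics before
and after the exchange of `i` and `j`. The conditioned permutation is obtained from an unconditioned
one by two transpositions (`sum_forceValue_forceValue`), and each transposition moves the statistic
by at most `4 * ‖a‖`, whence `δ = 12 * ‖a‖`.
-/

/-! ### Gaussian tails and Stein's equation -/

lemma integrable_exp_neg_sq_half : Integrable (fun x : ℝ => Real.exp (-x ^ 2 / 2)) := by
  have h := integrable_exp_neg_mul_sq (b := 1 / 2) (by norm_num)
  refine h.congr (Filter.Eventually.of_forall fun x => ?_)
  simp only
  congr 1
  ring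

lemma integral_exp_neg_sq_half : ∫ x : ℝ, Real.exp (-x ^ 2 / 2) = √(2 * Real.pi) := by
  have h := integral_gaussian (1 / 2)
  rw [show Real.pi / (1 / 2) = 2 * Real.pi by ring] at h
  rw [← h]
  congr 1
  ext x
  congr 1
  ring

lemma sqrt_two_pi_le_three : √(2 * Real.pi) ≤ 3 := by
  rw [Real.sqrt_le_left (by norm_num)]
  linarith [Real.pi_lt_four]

/-- The Gaussian tail beyond `w ≥ 0` loses at least the factor `exp (-w ^ 2 / 2)`, because
`x ^ 2 ≥ w ^ 2 + (x - w) ^ 2` for `x ≥ w`. -/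
lemma gaussian_tail_le {w : ℝ} (hw : 0 ≤ w) :
    ∫ x in Set.Ioi w, Real.exp (-x ^ 2 / 2) ≤ 3 * Real.exp (-w ^ 2 / 2) := by
  have hint : Integrable (fun x : ℝ => Real.exp (-w ^ 2 / 2) * Real.exp (-(x - w) ^ 2 / 2)) :=
    (integrable_exp_neg_sq_half.comp_sub_right w).const_mul _
  calc ∫ x in Set.Ioi w, Real.exp (-x ^ 2 / 2)
      ≤ ∫ x in Set.Ioi w, Real.exp (-w ^ 2 / 2) * Real.exp (-(x - w) ^ 2 / 2) := by
        refine setIntegral_mono_on integrable_exp_neg_sq_half.integrableOn hint.integrableOn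
          measurableSet_Ioi fun x hx => ?_
        rw [← Real.exp_add, Real.exp_le_exp]
        nlinarith [mul_nonneg hw (sub_nonneg.2 (le_of_lt (Set.mem_Ioi.1 hx)))]
    _ ≤ ∫ x : ℝ, Real.exp (-w ^ 2 / 2) * Real.exp (-(x - w) ^ 2 / 2) :=
        setIntegral_le_integral hint (Filter.Eventually.of_forall fun x => by positivity)
    _ = Real.exp (-w ^ 2 / 2) * √(2 * Real.pi) := by
        rw [integral_const_mul, ← integral_exp_neg_sq_half]
        congr 1
        exact integral_sub_right_eq_self (fun x : ℝ => Real.exp (-x ^ 2 / 2)) w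
    _ ≤ 3 * Real.exp (-w ^ 2 / 2) := by
        nlinarith [sqrt_two_pi_le_three, Real.exp_pos (-w ^ 2 / 2)]

/-- Mills' inequality for the Gaussian tail. -/
lemma mul_gaussian_tail_le {w : ℝ} (hw : 0 ≤ w) :
    w * ∫ x in Set.Ioi w, Real.exp (-x ^ 2 / 2) ≤ Real.exp (-w ^ 2 / 2) := by
  have hder : ∀ x ∈ Set.Ici w, HasDerivAt (fun x : ℝ => -Real.exp (-x ^ 2 / 2))
      (x * Real.exp (-x ^ 2 / 2)) x := fun x _ => by
    have h : HasDerivAt (fun x : ℝ => -x ^ 2 / 2) (-x) x :=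
      (((hasDerivAt_pow 2 x).neg).div_const 2).congr_deriv (by push_cast; ring)
    exact h.exp.neg.congr_deriv (by ring)
  have hlim : Filter.Tendsto (fun x : ℝ => -Real.exp (-x ^ 2 / 2)) Filter.atTop (nhds (-0)) := by
    refine (Real.tendsto_exp_atBot.comp ?_).neg
    have h := (Filter.tendsto_pow_atTop (α := ℝ) two_ne_zero).const_mul_atTop_of_neg
      (show (-1 / 2 : ℝ) < 0 by norm_num)
    refine h.congr fun x => ?_
    ring
  have hpos : ∀ x ∈ Set.Ioi w, 0 ≤ x * Real.exp (-x ^ 2 / 2) := fun x hx =>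
    mul_nonneg (hw.trans (le_of_lt hx)) (Real.exp_pos _).le
  have hint := integrableOn_Ioi_deriv_of_nonneg' hder hpos hlim
  have heq := integral_Ioi_of_hasDerivAt_of_nonneg' hder hpos hlim
  rw [← integral_const_mul]
  calc ∫ x in Set.Ioi w, w * Real.exp (-x ^ 2 / 2)
      ≤ ∫ x in Set.Ioi w, x * Real.exp (-x ^ 2 / 2) := by
        refine setIntegral_mono_on (integrable_exp_neg_sq_half.const_mul w).integrableOn hint
          measurableSet_Ioi fun x hx => ?_
        exact mul_le_mul_of_nonneg_right (le_of_lt hx) (Real.exp_pos _).le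
    _ = Real.exp (-w ^ 2 / 2) := by rw [heq]; ring

/-- The bounded solution of Stein's equation `f' w - w * f w = g w` for a continuous `g` with
`|g| ≤ 1` and mean zero under the standard normal law. -/
lemma exists_stein_solution {g : ℝ → ℝ} (hg : Continuous g) (hg1 : ∀ x, |g x| ≤ 1)
    (hg0 : ∫ x, g x * Real.exp (-x ^ 2 / 2) = 0) :
    ∃ f : ℝ → ℝ, (∀ w, HasDerivAt f (w * f w + g w) w) ∧ (∀ w, |f w| ≤ 3) ∧
      ∀ w, |w * f w| ≤ 1 := by
  set k : ℝ → ℝ := fun x => g x * Real.exp (-x ^ 2 / 2) with hk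
  have hkc : Continuous k := by fun_prop
  have hle : ∀ x, ‖k x‖ ≤ Real.exp (-x ^ 2 / 2) := fun x => by
    rw [hk, norm_mul, Real.norm_eq_abs, Real.norm_eq_abs, Real.abs_exp]
    exact mul_le_of_le_one_left (Real.exp_pos _).le (hg1 x)
  have hki : Integrable k := integrable_exp_neg_sq_half.mono' hkc.aestronglyMeasurable
    (Filter.Eventually.of_forall hle)
  set F : ℝ → ℝ := fun w => ∫ x in Set.Iic w, k x with hF
  have hFd : ∀ w, HasDerivAt F (k w) w := fun w => by
    have h1 : ∀ v, F v = F 0 + ∫ x in (0 : ℝ)..v, k x := fun v => by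
      rw [← intervalIntegral.integral_Iic_sub_Iic hki.integrableOn hki.integrableOn]
      simp [hF]
    rw [funext h1]
    exact (intervalIntegral.integral_hasDerivAt_right (hkc.intervalIntegrable _ _)
      (hkc.stronglyMeasurableAtFilter _ _) hkc.continuousAt).const_add _
  have hFt : ∀ w, |F w| ≤ ∫ x in Set.Ioi |w|, Real.exp (-x ^ 2 / 2) := fun w => by
    rcases le_total 0 w with hw | hw
    · have h := intervalIntegral.integral_Iic_add_Ioi (b := w) (f := k) (μ := volume)
        hki.integrableOn hki.integrableOn
      rw [hg0] at h
      rw [show F w = -∫ x in Set.Ioi w, k x from eq_neg_of_add_eq_zero_left h, abs_neg,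
        abs_of_nonneg hw]
      exact norm_integral_le_of_norm_le integrable_exp_neg_sq_half.integrableOn
        (Filter.Eventually.of_forall hle)
    · rw [abs_of_nonpos hw]
      have h := integral_comp_neg_Iic w (fun x : ℝ => Real.exp (-x ^ 2 / 2))
      simp only [neg_sq] at h
      rw [← h]
      exact norm_integral_le_of_norm_le integrable_exp_neg_sq_half.integrableOn
        (Filter.Eventually.of_forall hle)
  have hexp : ∀ w : ℝ, Real.exp (w ^ 2 / 2) * Real.exp (-|w| ^ 2 / 2) = 1 := fun w => by
    rw [sq_abs, ← Real.exp_add, show w ^ 2 / 2 + -w ^ 2 / 2 = 0 by ring, Real.exp_zero]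
  refine ⟨fun w => Real.exp (w ^ 2 / 2) * F w, fun w => ?_, fun w => ?_, fun w => ?_⟩
  · have h : HasDerivAt (fun x : ℝ => x ^ 2 / 2) w w :=
      ((hasDerivAt_pow 2 w).div_const 2).congr_deriv (by push_cast; ring)
    have h2 := hexp w
    rw [sq_abs] at h2
    refine (h.exp.mul (hFd w)).congr_deriv ?_
    simp only [hk]
    linear_combination (g w) * h2
  · rw [abs_mul, Real.abs_exp]
    have h1 := (hFt w).trans (gaussian_tail_le (abs_nonneg w))
    nlinarith [hexp w, mul_le_mul_of_nonneg_left h1 (Real.exp_pos (w ^ 2 / 2)).le]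
  · rw [abs_mul, abs_mul, Real.abs_exp]
    have h1 := (mul_le_mul_of_nonneg_left (hFt w) (abs_nonneg w)).trans
      (mul_gaussian_tail_le (abs_nonneg w))
    nlinarith [hexp w, mul_le_mul_of_nonneg_left h1 (Real.exp_pos (w ^ 2 / 2)).le]

lemma integral_gaussianReal_std (h : ℝ → ℝ) :
    ∫ x, h x ∂(gaussianReal 0 1) = (√(2 * Real.pi))⁻¹ * ∫ x, h x * Real.exp (-x ^ 2 / 2) := by
  rw [integral_gaussianReal_eq_integral_smul one_ne_zero, ← integral_const_mul]
  congr 1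
  ext x
  simp [gaussianPDFReal]
  ring

lemma gaussianReal_std_real_Ioc_le {x y : ℝ} (hxy : x ≤ y) :
    (gaussianReal 0 1).real (Set.Ioc x y) ≤ y - x := by
  have h : (gaussianReal 0 1) (Set.Ioc x y) ≤ ENNReal.ofReal (y - x) := by
    rw [gaussianReal_apply _ one_ne_zero, ← Real.volume_Ioc, ← setLIntegral_one]
    refine lintegral_mono fun t => ?_
    rw [gaussianPDF, ENNReal.ofReal_le_one, gaussianPDFReal]
    have h1 : (√(2 * Real.pi * ((1 : NNReal) : ℝ)))⁻¹ ≤ 1 := by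
      refine inv_le_one_of_one_le₀ (Real.one_le_sqrt.2 ?_)
      simp only [NNReal.coe_one]
      linarith [Real.pi_gt_three]
    refine mul_le_one₀ h1 (Real.exp_pos _).le (Real.exp_le_one_iff.2 ?_)
    simp only [NNReal.coe_one]
    nlinarith [sq_nonneg (t - 0)]
  exact ENNReal.toReal_le_of_le_ofReal (by linarith) h

/-- The standard normal density is at most `1`. -/
lemma cdf_gaussianReal_std_le {x y : ℝ} (hxy : x ≤ y) :
    cdf (gaussianReal 0 1) y ≤ cdf (gaussianReal 0 1) x + (y - x) := by
  rw [cdf_eq_real, cdf_eq_real, ← Set.Iic_union_Ioc_eq_Iic hxy]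
  exact (measureReal_union_le _ _).trans (by gcongr; exact gaussianReal_std_real_Ioc_le hxy)

/-! ### Bounded zero-bias couplings -/

lemma abs_segment_sub_le {x y w δ u : ℝ} (hx : |x - w| ≤ δ) (hy : |y - w| ≤ δ)
    (hu : u ∈ Set.Icc (0 : ℝ) 1) : |y + u * (x - y) - w| ≤ δ := by
  have hx := abs_le.1 hx
  have hy := abs_le.1 hy
  refine abs_le.2 ⟨?_, ?_⟩
  · nlinarith [mul_nonneg hu.1 (neg_le_iff_add_nonneg.1 hx.1),
      mul_nonneg (sub_nonneg.2 hu.2) (neg_le_iff_add_nonneg.1 hy.1)]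
  · nlinarith [mul_nonneg hu.1 (sub_nonneg.2 hx.2),
      mul_nonneg (sub_nonneg.2 hu.2) (sub_nonneg.2 hy.2)]

/-- Quantitative Stein bound for a bounded zero-bias coupling, tested against a continuous
`h : ℝ → [0, 1]`. The zero-biased variable is `Y t + u * (X t - Y t)`, with `t` drawn according to
the weights `p` and `u` uniform on `[0, 1]`. -/
lemma abs_zeroBias_sub_integral_gaussian_le {T : Type*} [Fintype T] {p W X Y : T → ℝ} {δ : ℝ}
    (hp : ∀ t, 0 ≤ p t) (hp1 : ∑ t, p t = 1)
    (hX : ∀ t, |X t - W t| ≤ δ) (hY : ∀ t, |Y t - W t| ≤ δ)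
    (hzb : ∀ f f' : ℝ → ℝ, (∀ x, HasDerivAt f (f' x) x) → Continuous f' →
      ∑ t, p t * (W t * f (W t)) = ∑ t, p t * ∫ u in (0 : ℝ)..1, f' (Y t + u * (X t - Y t)))
    {h : ℝ → ℝ} (hh : Continuous h) (h0 : ∀ x, 0 ≤ h x) (h1 : ∀ x, h x ≤ 1) :
    |∑ t, p t * (∫ u in (0 : ℝ)..1, h (Y t + u * (X t - Y t))) - ∫ x, h x ∂(gaussianReal 0 1)|
      ≤ 5 * δ := by
  set m := ∫ x, h x ∂(gaussianReal 0 1) with hm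
  have hhi : Integrable h (gaussianReal 0 1) := Integrable.of_bound hh.aestronglyMeasurable 1
    (Filter.Eventually.of_forall fun x => by rw [Real.norm_eq_abs, abs_of_nonneg (h0 x)]; exact h1 x)
  have hm0 : 0 ≤ m := integral_nonneg h0
  have hm1 : m ≤ 1 := by
    calc m ≤ ∫ x, (1 : ℝ) ∂(gaussianReal 0 1) := integral_mono hhi (integrable_const _) h1
      _ = 1 := by simp
  obtain ⟨f, hfd, hf3, hf1⟩ := exists_stein_solution (g := fun x => h x - m)
    (hh.sub continuous_const)
    (fun x => abs_le.2 ⟨by linarith [h0 x], by linarith [h1 x]⟩) (by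
      have h2 := integral_gaussianReal_std fun x => h x - m
      rw [integral_sub hhi (integrable_const _), ← hm] at h2
      simp only [integral_const, probReal_univ, one_smul, sub_self] at h2
      exact (mul_eq_zero.1 h2.symm).resolve_left (by positivity))
  have hfc : Continuous f := continuous_iff_continuousAt.2 fun x => (hfd x).continuousAt
  have hf2 : ∀ x, |x * f x + (h x - m)| ≤ 2 := fun x => by
    have := abs_le.1 (hf1 x)
    exact abs_le.2 ⟨by linarith [h0 x], by linarith [h1 x]⟩
  have hlip : ∀ x y, |f x - f y| ≤ 2 * |x - y| := fun x y =>
    Convex.norm_image_sub_le_of_norm_hasDerivWithin_le (s := Set.univ)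
      (fun z _ => (hfd z).hasDerivWithinAt) (fun z _ => hf2 z) convex_univ trivial trivial
  have hmean : ∀ x y, |x * f x - y * f y| ≤ (2 * |x| + 3) * |x - y| := fun x y => by
    calc |x * f x - y * f y| = |x * (f x - f y) + (x - y) * f y| := by ring_nf
      _ ≤ |x| * |f x - f y| + |x - y| * |f y| := by
        rw [← abs_mul, ← abs_mul]; exact abs_add_le _ _
      _ ≤ |x| * (2 * |x - y|) + |x - y| * 3 := by
        gcongr
        · exact hlip x y
        · exact hf3 y
      _ = _ := by ring
  have hWstar : ∀ t, ∀ u ∈ Set.Icc (0 : ℝ) 1, |W t - (Y t + u * (X t - Y t))| ≤ δ :=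
    fun t u hu => by
      rw [abs_sub_comm]
      exact abs_segment_sub_le (hX t) (hY t) hu
  -- The identity for `f = id` says that `W` has unit variance, whence `E |W| ≤ 1`.
  have hW : ∑ t, p t * |W t| ≤ 1 := by
    have h2 := hzb id (fun _ => 1) (fun x => hasDerivAt_id x) continuous_const
    simp only [id, intervalIntegral.integral_const, sub_zero, smul_eq_mul, mul_one, hp1] at h2
    have h3 : ∑ t, p t * (2 * |W t|) ≤ ∑ t, p t * (1 + W t * W t) :=
      Finset.sum_le_sum fun t _ => mul_le_mul_of_nonneg_left
        (by nlinarith [sq_nonneg (|W t| - 1), abs_mul_abs_self (W t)]) (hp t)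
    simp only [mul_add, Finset.sum_add_distrib, h2, mul_one, hp1, mul_left_comm _ (2 : ℝ),
      ← Finset.mul_sum] at h3
    linarith
  have key : ∑ t, p t * (∫ u in (0 : ℝ)..1, h (Y t + u * (X t - Y t))) - m =
      ∑ t, p t * ∫ u in (0 : ℝ)..1,
        (W t * f (W t) - (Y t + u * (X t - Y t)) * f (Y t + u * (X t - Y t))) := by
    have h2 := hzb f (fun x => x * f x + (h x - m)) hfd (by fun_prop)
    have h3 : m = ∑ t, p t * m := by rw [← Finset.sum_mul, hp1, one_mul]
    have h4 : ∀ t, ∫ u in (0 : ℝ)..1, ((Y t + u * (X t - Y t)) * f (Y t + u * (X t - Y t)) +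
          (h (Y t + u * (X t - Y t)) - m)) =
        (∫ u in (0 : ℝ)..1, (Y t + u * (X t - Y t)) * f (Y t + u * (X t - Y t))) +
          ((∫ u in (0 : ℝ)..1, h (Y t + u * (X t - Y t))) - m) := fun t => by
      rw [intervalIntegral.integral_add, intervalIntegral.integral_sub]
      · simp
      all_goals exact Continuous.intervalIntegrable (by fun_prop) _ _
    have h5 : ∀ t, ∫ u in (0 : ℝ)..1,
          (W t * f (W t) - (Y t + u * (X t - Y t)) * f (Y t + u * (X t - Y t))) =
        W t * f (W t) -
          ∫ u in (0 : ℝ)..1, (Y t + u * (X t - Y t)) * f (Y t + u * (X t - Y t)) := fun t => by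
      rw [intervalIntegral.integral_sub]
      · simp
      all_goals exact Continuous.intervalIntegrable (by fun_prop) _ _
    simp_rw [h4] at h2
    simp_rw [h5]
    rw [h3, ← Finset.sum_sub_distrib]
    rw [← sub_eq_zero, ← Finset.sum_sub_distrib] at h2 ⊢
    refine neg_eq_zero.1 (Eq.trans ?_ h2)
    rw [← Finset.sum_neg_distrib]
    exact Finset.sum_congr rfl fun t _ => by ring
  rw [key]
  calc _ ≤ ∑ t, |p t * ∫ u in (0 : ℝ)..1,
        (W t * f (W t) - (Y t + u * (X t - Y t)) * f (Y t + u * (X t - Y t)))| :=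
        Finset.abs_sum_le_sum_abs _ _
    _ ≤ ∑ t, p t * ((2 * |W t| + 3) * δ) := by
        refine Finset.sum_le_sum fun t _ => ?_
        rw [abs_mul, abs_of_nonneg (hp t)]
        refine mul_le_mul_of_nonneg_left ?_ (hp t)
        have h2 := intervalIntegral.norm_integral_le_of_norm_le_const (a := (0 : ℝ)) (b := 1)
          (C := (2 * |W t| + 3) * δ) (f := fun u =>
            W t * f (W t) - (Y t + u * (X t - Y t)) * f (Y t + u * (X t - Y t))) fun u hu => by
          rw [Set.uIoc_of_le zero_le_one] at hu
          exact (hmean _ _).trans (mul_le_mul_of_nonneg_left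
            (hWstar t u ⟨hu.1.le, hu.2⟩) (by positivity))
        simpa using h2
    _ = (2 * ∑ t, p t * |W t| + 3) * δ := by
        rw [add_mul, Finset.mul_sum, Finset.sum_mul]
        have : 3 * δ = ∑ t, p t * (3 * δ) := by rw [← Finset.sum_mul, hp1, one_mul]
        rw [this, ← Finset.sum_add_distrib]
        exact Finset.sum_congr rfl fun t _ => by ring
    _ ≤ 5 * δ := by
        have hT : Nonempty T := by
          by_contra hT
          rw [not_nonempty_iff] at hT
          simp at hp1
        have hδ : 0 ≤ δ := (abs_nonneg _).trans (hX hT.some)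
        exact mul_le_mul_of_nonneg_right (by linarith) hδ

/-- The continuous function equal to `1` on `(-∞, z]` and to `0` on `[z + δ, ∞)`, and affine in
between. -/
noncomputable def ramp (z δ x : ℝ) : ℝ := max 0 (min 1 ((z + δ - x) / δ))

lemma continuous_ramp (z δ : ℝ) : Continuous (ramp z δ) := by
  unfold ramp
  fun_prop

lemma ramp_nonneg (z δ x : ℝ) : 0 ≤ ramp z δ x := le_max_left _ _

lemma ramp_le_one (z δ x : ℝ) : ramp z δ x ≤ 1 := max_le zero_le_one (min_le_left _ _)

lemma ramp_eq_one {z δ x : ℝ} (hδ : 0 < δ) (hx : x ≤ z) : ramp z δ x = 1 := by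
  have : 1 ≤ (z + δ - x) / δ := by rw [le_div_iff₀ hδ]; linarith
  simp [ramp, this]

lemma ramp_eq_zero {z δ x : ℝ} (hδ : 0 < δ) (hx : z + δ ≤ x) : ramp z δ x = 0 := by
  have : (z + δ - x) / δ ≤ 0 := div_nonpos_of_nonpos_of_nonneg (by linarith) hδ.le
  exact max_eq_left ((min_le_right _ _).trans this)

lemma integral_ramp_bounds (z : ℝ) {δ : ℝ} (hδ : 0 < δ) :
    cdf (gaussianReal 0 1) z ≤ ∫ x, ramp z δ x ∂(gaussianReal 0 1) ∧
      ∫ x, ramp z δ x ∂(gaussianReal 0 1) ≤ cdf (gaussianReal 0 1) (z + δ) := by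
  have hi : Integrable (ramp z δ) (gaussianReal 0 1) :=
    Integrable.of_bound (continuous_ramp z δ).aestronglyMeasurable 1
      (Filter.Eventually.of_forall fun x => by
        rw [Real.norm_eq_abs, abs_of_nonneg (ramp_nonneg z δ x)]; exact ramp_le_one z δ x)
  have hind : ∀ y : ℝ, Integrable ((Set.Iic y).indicator (1 : ℝ → ℝ)) (gaussianReal 0 1) :=
    fun y => (integrable_const (1 : ℝ)).indicator measurableSet_Iic
  rw [cdf_eq_real, cdf_eq_real, ← integral_indicator_one measurableSet_Iic,
    ← integral_indicator_one measurableSet_Iic]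
  refine ⟨integral_mono (hind _) hi fun x => ?_, integral_mono hi (hind _) fun x => ?_⟩
  · by_cases hx : x ≤ z
    · simp [hx, ramp_eq_one hδ hx]
    · simpa [hx] using ramp_nonneg z δ x
  · by_cases hx : x ≤ z + δ
    · simpa [hx] using ramp_le_one z δ x
    · simp [hx, ramp_eq_zero hδ (le_of_not_ge hx)]

/-- **Berry–Esseen bound for bounded zero-bias couplings.** -/
theorem abs_sub_cdf_gaussian_le_of_zeroBias {T : Type*} [Fintype T] {p W X Y : T → ℝ} {δ : ℝ}
    (hδ : 0 < δ) (hp : ∀ t, 0 ≤ p t) (hp1 : ∑ t, p t = 1)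
    (hX : ∀ t, |X t - W t| ≤ δ) (hY : ∀ t, |Y t - W t| ≤ δ)
    (hzb : ∀ f f' : ℝ → ℝ, (∀ x, HasDerivAt f (f' x) x) → Continuous f' →
      ∑ t, p t * (W t * f (W t)) = ∑ t, p t * ∫ u in (0 : ℝ)..1, f' (Y t + u * (X t - Y t)))
    (z : ℝ) :
    |∑ t, p t * (if W t ≤ z then 1 else 0) - cdf (gaussianReal 0 1) z| ≤ 7 * δ := by
  have main := fun y : ℝ => abs_le.1 (abs_zeroBias_sub_integral_gaussian_le hp hp1 hX hY hzb
    (continuous_ramp y δ) (ramp_nonneg y δ) (ramp_le_one y δ))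
  have hWstar : ∀ t, ∀ u ∈ Set.Icc (0 : ℝ) 1, W t - δ ≤ Y t + u * (X t - Y t) ∧
      Y t + u * (X t - Y t) ≤ W t + δ := by
    intro t u hu
    have h := abs_le.1 (abs_segment_sub_le (hX t) (hY t) hu)
    constructor <;> linarith
  have hint : ∀ y t, IntervalIntegrable (fun u : ℝ => ramp y δ (Y t + u * (X t - Y t)))
      volume 0 1 := fun y t =>
    ((continuous_ramp y δ).comp (by fun_prop)).intervalIntegrable _ _
  have hconst : ∀ c : ℝ, ∫ _u in (0 : ℝ)..1, c = c := fun c => by simp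
  rw [abs_le]
  constructor
  · -- `W* ≤ z - δ` forces `W ≤ z`; the ramp descends from `z - 2 * δ` to `z - δ`.
    have h1 : ∑ t, p t * ∫ u in (0 : ℝ)..1, ramp (z - 2 * δ) δ (Y t + u * (X t - Y t)) ≤
        ∑ t, p t * (if W t ≤ z then 1 else 0) := by
      refine Finset.sum_le_sum fun t _ => mul_le_mul_of_nonneg_left ?_ (hp t)
      rw [← hconst (if W t ≤ z then 1 else 0)]
      refine intervalIntegral.integral_mono_on zero_le_one (hint _ t)
        intervalIntegrable_const fun u hu => ?_
      split_ifs with hz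
      · exact ramp_le_one _ _ _
      · exact (ramp_eq_zero hδ (by linarith [(hWstar t u hu).1])).le
    have h2 := (integral_ramp_bounds (z - 2 * δ) hδ).1
    have h3 := cdf_gaussianReal_std_le (x := z - 2 * δ) (y := z) (by linarith)
    linarith [(main (z - 2 * δ)).1]
  · -- `W ≤ z` forces `W* ≤ z + δ`; the ramp descends from `z + δ` to `z + 2 * δ`.
    have h1 : ∑ t, p t * (if W t ≤ z then 1 else 0) ≤
        ∑ t, p t * ∫ u in (0 : ℝ)..1, ramp (z + δ) δ (Y t + u * (X t - Y t)) := by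
      refine Finset.sum_le_sum fun t _ => mul_le_mul_of_nonneg_left ?_ (hp t)
      rw [← hconst (if W t ≤ z then 1 else 0)]
      refine intervalIntegral.integral_mono_on zero_le_one intervalIntegrable_const
        (hint _ t) fun u hu => ?_
      split_ifs with hz
      · exact (ramp_eq_one hδ (by linarith [(hWstar t u hu).2])).ge
      · exact ramp_nonneg _ _ _
    have h2 := (integral_ramp_bounds (z + δ) hδ).2
    have h3 := cdf_gaussianReal_std_le (x := z) (y := z + δ + δ) (by linarith)
    linarith [(main (z + δ)).2]

/-! ### Transpositions and conditioned permutations -/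

/-- The decrease of `permSum a` when the values `k`, `l` at the positions `i`, `j` are exchanged. -/
def swapDiff {ι : Type*} (a : ι → ι → ℝ) (i j k l : ι) : ℝ := a i k + a j l - a i l - a j k

lemma swapDiff_eq_zero {ι : Type*} (a : ι → ι → ℝ) {i j k l : ι} (h : i = j ∨ k = l) :
    swapDiff a i j k l = 0 := by
  rcases h with rfl | rfl <;> simp [swapDiff]

lemma abs_swapDiff_le {ι : Type*} {a : ι → ι → ℝ} {A : ℝ} (hA : ∀ i j, |a i j| ≤ A) (i j k l : ι) :
    |swapDiff a i j k l| ≤ 4 * A := by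
  have h1 := abs_le.1 (hA i k)
  have h2 := abs_le.1 (hA j l)
  have h3 := abs_le.1 (hA i l)
  have h4 := abs_le.1 (hA j k)
  unfold swapDiff
  exact abs_le.2 ⟨by linarith, by linarith⟩

section Combinatorics

variable {ι : Type*} [Fintype ι]

/-- The statistic `∑ i, a i (σ i)` of a permutation `σ`. -/
def permSum (a : ι → ι → ℝ) (σ : Equiv.Perm ι) : ℝ := ∑ i, a i (σ i)

/-- The linear regression property behind the exchangeable pair `(σ, σ * swap i j)`: the mean
decrease under a random exchange is proportional to `permSum a σ`. -/
lemma sum_swapDiff_apply {a : ι → ι → ℝ} (hrow : ∀ i, ∑ k, a i k = 0) (σ : Equiv.Perm ι) :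
    ∑ i, ∑ j, swapDiff a i j (σ i) (σ j) = 2 * Fintype.card ι * permSum a σ := by
  have h : ∀ i, ∑ j, a i (σ j) = 0 := fun i => by
    rw [Equiv.sum_comp σ (a i), hrow]
  have h' : ∑ i, ∑ j, a j (σ i) = 0 := by
    rw [Finset.sum_comm]
    exact Finset.sum_eq_zero fun i _ => h i
  simp only [swapDiff, Finset.sum_sub_distrib, Finset.sum_add_distrib, h', h, Finset.sum_const,
    Finset.card_univ, nsmul_eq_mul, ← Finset.mul_sum, permSum]
  ring

/-- The total mass of the square-bias weights: the additive structure of `swapDiff` and the vanishing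
row and column sums kill all cross terms. -/
lemma sum_swapDiff_sq {a : ι → ι → ℝ} (hrow : ∀ i, ∑ k, a i k = 0)
    (hcol : ∀ j, ∑ k, a k j = 0) :
    ∑ i, ∑ j, ∑ k, ∑ l, swapDiff a i j k l ^ 2 =
      4 * (Fintype.card ι : ℝ) ^ 2 * ∑ i, ∑ j, a i j ^ 2 := by
  have h : ∀ i j, ∑ k, ∑ l, swapDiff a i j k l ^ 2 =
      2 * Fintype.card ι * ∑ k, (a i k - a j k) ^ 2 := fun i j => by
    have h1 : ∀ k l, swapDiff a i j k l ^ 2 = (a i k - a j k) ^ 2 + (a i l - a j l) ^ 2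
        - 2 * (a i k - a j k) * (a i l - a j l) := fun k l => by unfold swapDiff; ring
    simp only [h1, Finset.sum_sub_distrib, Finset.sum_add_distrib, ← Finset.mul_sum, hrow,
      Finset.sum_const, Finset.card_univ, nsmul_eq_mul, sub_zero, mul_zero]
    ring
  have h2 : ∀ i j, ∑ k, (a i k - a j k) ^ 2 =
      ∑ k, a i k ^ 2 + ∑ k, a j k ^ 2 - 2 * ∑ k, a i k * a j k := fun i j => by
    rw [Finset.mul_sum, ← Finset.sum_add_distrib, ← Finset.sum_sub_distrib]
    exact Finset.sum_congr rfl fun k _ => by ring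
  have h3 : ∀ i, ∑ j, ∑ k, a i k * a j k = 0 := fun i => by
    rw [Finset.sum_comm]
    exact Finset.sum_eq_zero fun k _ => by rw [← Finset.mul_sum, hcol, mul_zero]
  simp only [h, h2, ← Finset.mul_sum, Finset.sum_sub_distrib, Finset.sum_add_distrib, h3,
      Finset.sum_const, Finset.card_univ, nsmul_eq_mul]
  simp
  ring

variable [DecidableEq ι]

/-- The permutation that agrees with `σ` except that the value `k` has been moved to position `i`,
in exchange for the value that was there. -/
def forceValue (i k : ι) (σ : Equiv.Perm ι) : Equiv.Perm ι := Equiv.swap k (σ i) * σ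

lemma permSum_sub_permSum_mul_swap (a : ι → ι → ℝ) (σ : Equiv.Perm ι) (i j : ι) :
    permSum a σ - permSum a (σ * Equiv.swap i j) = swapDiff a i j (σ i) (σ j) := by
  rcases eq_or_ne i j with rfl | hij
  · rw [Equiv.swap_self, swapDiff_eq_zero a (Or.inl rfl), sub_eq_zero]
    rfl
  · unfold permSum
    rw [← Finset.sum_sub_distrib, Fintype.sum_eq_add i j hij]
    · simp [swapDiff]
      ring
    · rintro x ⟨hxi, hxj⟩
      simp [Equiv.swap_apply_of_ne_of_ne hxi hxj]

lemma abs_permSum_mul_swap_sub_le {a : ι → ι → ℝ} {A : ℝ} (hA : ∀ i j, |a i j| ≤ A)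
    (σ : Equiv.Perm ι) (i j : ι) :
    |permSum a (σ * Equiv.swap i j) - permSum a σ| ≤ 4 * A := by
  rw [abs_sub_comm, permSum_sub_permSum_mul_swap]
  exact abs_swapDiff_le hA _ _ _ _

lemma abs_permSum_forceValue_sub_le {a : ι → ι → ℝ} {A : ℝ} (hA : ∀ i j, |a i j| ≤ A)
    (σ : Equiv.Perm ι) (i k : ι) :
    |permSum a (forceValue i k σ) - permSum a σ| ≤ 4 * A := by
  have h : forceValue i k σ = σ * Equiv.swap (σ⁻¹ k) i := by
    rw [forceValue, Equiv.mul_swap_eq_swap_mul]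
    simp
  rw [h]
  exact abs_permSum_mul_swap_sub_le hA _ _ _

/-- `forceValue i k` carries the uniform distribution on all permutations to the uniform
distribution on the permutations with `σ i = k`. -/
lemma sum_forceValue (F : Equiv.Perm ι → ℝ) (i k : ι) :
    ∑ σ, F (forceValue i k σ) = Fintype.card ι * ∑ σ with σ i = k, F σ := by
  rw [← Finset.sum_fiberwise Finset.univ (fun σ : Equiv.Perm ι => σ i)]
  have h : ∀ m : ι, ∑ σ with σ i = m, F (forceValue i k σ) =
      ∑ σ with σ i = k, F σ := fun m => by
    refine Finset.sum_equiv (Equiv.mulLeft (Equiv.swap k m)) (fun σ => ?_) fun σ hσ => ?_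
    · simp [Equiv.swap_apply_eq_iff]
    · simp only [Finset.mem_filter, Finset.mem_univ, true_and] at hσ
      simp [forceValue, hσ]
  rw [Finset.sum_congr rfl fun m _ => h m]
  simp

/-- Among the permutations with `σ i = k`, the map `forceValue j l` produces the uniform
distribution on those with also `σ j = l`. -/
lemma sum_forceValue_of_apply_eq (F : Equiv.Perm ι → ℝ) {i j k l : ι} (hij : i ≠ j)
    (hkl : k ≠ l) :
    ∑ σ with σ i = k, F (forceValue j l σ) =
      (Fintype.card ι - 1) * ∑ σ with σ i = k ∧ σ j = l, F σ := by
  rw [← Finset.sum_fiberwise _ (fun σ : Equiv.Perm ι => σ j)]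
  simp only [Finset.filter_filter]
  have h : ∀ m ∈ Finset.univ.erase k, ∑ σ with σ i = k ∧ σ j = m, F (forceValue j l σ) =
      ∑ σ with σ i = k ∧ σ j = l, F σ := fun m hm => by
    have hmk : k ≠ m := (Finset.ne_of_mem_erase hm).symm
    refine Finset.sum_equiv (Equiv.mulLeft (Equiv.swap l m)) (fun σ => ?_) fun σ hσ => ?_
    · simp [Equiv.swap_apply_eq_iff, Equiv.swap_apply_of_ne_of_ne hkl hmk]
    · simp only [Finset.mem_filter, Finset.mem_univ, true_and] at hσ
      simp [forceValue, hσ.2]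
  have h0 : ∑ σ with σ i = k ∧ σ j = k, F (forceValue j l σ) = 0 := by
    refine Finset.sum_eq_zero fun σ hσ => ?_
    simp only [Finset.mem_filter, Finset.mem_univ, true_and] at hσ
    exact absurd (σ.injective (hσ.1.trans hσ.2.symm)) hij
  rw [← Finset.add_sum_erase _ _ (Finset.mem_univ k), h0, zero_add, Finset.sum_congr rfl h,
    Finset.sum_const, Finset.card_erase_of_mem (Finset.mem_univ k), Finset.card_univ, nsmul_eq_mul,
    Nat.cast_pred (Fintype.card_pos_iff.2 ⟨k⟩)]

lemma sum_forceValue_forceValue (F : Equiv.Perm ι → ℝ) {i j k l : ι} (hij : i ≠ j)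
    (hkl : k ≠ l) :
    ∑ σ, F (forceValue j l (forceValue i k σ)) =
      Fintype.card ι * (Fintype.card ι - 1) * ∑ σ with σ i = k ∧ σ j = l, F σ := by
  rw [sum_forceValue (fun σ => F (forceValue j l σ)), sum_forceValue_of_apply_eq F hij hkl,
    mul_assoc]

/-- The exchangeable-pair identity. Replacing `σ` by `σ * swap i j` changes the sign of
`swapDiff a i j (σ i) (σ j)`, so the two terms of the increment of `f` contribute equally, and each
contribution is given by `sum_swapDiff_apply`. -/
lemma sum_swapDiff_mul_increment {a : ι → ι → ℝ} (hrow : ∀ i, ∑ k, a i k = 0) (f : ℝ → ℝ) :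
    ∑ i, ∑ j, ∑ σ : Equiv.Perm ι, swapDiff a i j (σ i) (σ j) *
        (f (permSum a σ) - f (permSum a (σ * Equiv.swap i j))) =
      4 * Fintype.card ι * ∑ σ, permSum a σ * f (permSum a σ) := by
  have h1 : ∀ i j, ∑ σ : Equiv.Perm ι, swapDiff a i j (σ i) (σ j) *
        f (permSum a (σ * Equiv.swap i j)) =
      -∑ σ : Equiv.Perm ι, swapDiff a i j (σ i) (σ j) * f (permSum a σ) := fun i j => by
    rw [← Finset.sum_neg_distrib]
    refine Fintype.sum_equiv (Equiv.mulRight (Equiv.swap i j)) _ _ fun σ => ?_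
    simp only [Equiv.coe_mulRight, Equiv.Perm.coe_mul, Function.comp_apply, Equiv.swap_apply_left,
      Equiv.swap_apply_right, swapDiff]
    ring
  have h2 : ∑ i, ∑ j, ∑ σ : Equiv.Perm ι, swapDiff a i j (σ i) (σ j) * f (permSum a σ) =
      2 * Fintype.card ι * ∑ σ, permSum a σ * f (permSum a σ) := by
    rw [Finset.sum_congr rfl fun i _ => Finset.sum_comm, Finset.sum_comm, Finset.mul_sum]
    refine Finset.sum_congr rfl fun σ _ => ?_
    simp only [← Finset.sum_mul, sum_swapDiff_apply hrow]
    ring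
  simp only [mul_sub, Finset.sum_sub_distrib, h1, Finset.sum_neg_distrib, h2]
  ring

lemma mul_sub_eq_sq_mul_integral {f f' : ℝ → ℝ} (hf : ∀ x, HasDerivAt f (f' x) x)
    (hf' : Continuous f') (x y : ℝ) :
    (x - y) * (f x - f y) = (x - y) ^ 2 * ∫ u in (0 : ℝ)..1, f' (y + u * (x - y)) := by
  have hd : ∀ u : ℝ, HasDerivAt (fun u => f (y + u * (x - y)))
      (f' (y + u * (x - y)) * (x - y)) u := fun u => by
    have h : HasDerivAt (fun u : ℝ => y + u * (x - y)) (x - y) u := by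
      simpa using ((hasDerivAt_id u).mul_const (x - y)).const_add y
    exact (hf _).comp u h
  have h := intervalIntegral.integral_eq_sub_of_hasDerivAt (a := 0) (b := 1) (fun u _ => hd u)
    (Continuous.intervalIntegrable (by fun_prop) _ _)
  rw [intervalIntegral.integral_mul_const] at h
  simp only [one_mul, zero_mul, add_zero, add_sub_cancel] at h
  rw [← h]
  ring

/-- The zero-bias identity for `permSum a`, before normalization. Positions `i`, `j` and values `k`,
`l` are drawn with probability proportional to `swapDiff a i j k l ^ 2`; the permutation conditioned
on `σ i = k` and `σ j = l` is obtained from a uniform one by applying `forceValue` twice. -/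
lemma sum_permSum_mul_eq_zeroBias {a : ι → ι → ℝ} (hrow : ∀ i, ∑ k, a i k = 0)
    {f f' : ℝ → ℝ} (hf : ∀ x, HasDerivAt f (f' x) x)
    (hf' : Continuous f') :
    ∑ i, ∑ j, ∑ k, ∑ l, swapDiff a i j k l ^ 2 * ∑ σ : Equiv.Perm ι, ∫ u in (0 : ℝ)..1,
        f' (permSum a (forceValue j l (forceValue i k σ) * Equiv.swap i j) +
          u * (permSum a (forceValue j l (forceValue i k σ)) -
            permSum a (forceValue j l (forceValue i k σ) * Equiv.swap i j))) =
      4 * (Fintype.card ι : ℝ) ^ 2 * (Fintype.card ι - 1) *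
        ∑ σ, permSum a σ * f (permSum a σ) := by
  have hcond : ∀ i j k l, swapDiff a i j k l ^ 2 * ∑ σ : Equiv.Perm ι, ∫ u in (0 : ℝ)..1,
        f' (permSum a (forceValue j l (forceValue i k σ) * Equiv.swap i j) +
          u * (permSum a (forceValue j l (forceValue i k σ)) -
            permSum a (forceValue j l (forceValue i k σ) * Equiv.swap i j))) =
      Fintype.card ι * (Fintype.card ι - 1) * ∑ σ with σ i = k ∧ σ j = l,
        swapDiff a i j (σ i) (σ j) *
          (f (permSum a σ) - f (permSum a (σ * Equiv.swap i j))) := fun i j k l => by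
    by_cases h : i = j ∨ k = l
    · have h0 : ∑ σ with σ i = k ∧ σ j = l, swapDiff a i j (σ i) (σ j) *
          (f (permSum a σ) - f (permSum a (σ * Equiv.swap i j))) = 0 := by
        refine Finset.sum_eq_zero fun σ hσ => ?_
        simp only [Finset.mem_filter, Finset.mem_univ, true_and] at hσ
        rw [hσ.1, hσ.2, swapDiff_eq_zero a h, zero_mul]
      rw [h0, swapDiff_eq_zero a h]
      ring
    · push Not at h
      rw [sum_forceValue_forceValue (fun σ => ∫ u in (0 : ℝ)..1,
        f' (permSum a (σ * Equiv.swap i j) +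
          u * (permSum a σ - permSum a (σ * Equiv.swap i j)))) h.1 h.2, mul_left_comm,
        Finset.mul_sum]
      congr 1
      refine Finset.sum_congr rfl fun σ hσ => ?_
      simp only [Finset.mem_filter, Finset.mem_univ, true_and] at hσ
      rw [← permSum_sub_permSum_mul_swap, mul_sub_eq_sq_mul_integral hf hf',
        permSum_sub_permSum_mul_swap, hσ.1, hσ.2]
  have hfib : ∀ i j, ∀ F : Equiv.Perm ι → ℝ,
      ∑ k, ∑ l, ∑ σ with σ i = k ∧ σ j = l, F σ = ∑ σ, F σ := fun i j F => by
    rw [← Finset.sum_fiberwise Finset.univ (fun σ : Equiv.Perm ι => σ i)]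
    refine Finset.sum_congr rfl fun k _ => ?_
    rw [← Finset.sum_fiberwise _ (fun σ : Equiv.Perm ι => σ j)]
    simp only [Finset.filter_filter]
  simp only [hcond, ← Finset.mul_sum, hfib, sum_swapDiff_mul_increment hrow]
  ring

/-- Berry–Esseen bound for the combinatorial central limit theorem, as a statement about averages
over the symmetric group. The zero-biased variable lies on the segment between `X` and `Y`; two
applications of `forceValue` and one exchange of positions each move `permSum a` by at most `4 * A`,
so the coupling distance is at most `12 * A`. -/
theorem abs_permSum_distribution_sub_cdf_gaussian_le {a : ι → ι → ℝ} {A : ℝ}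
    (hrow : ∀ i, ∑ k, a i k = 0) (hcol : ∀ j, ∑ k, a k j = 0) (hn : 2 ≤ Fintype.card ι)
    (hvar : ∑ i, ∑ j, a i j ^ 2 = Fintype.card ι - 1) (hA : ∀ i j, |a i j| ≤ A) (z : ℝ) :
    |∑ σ : Equiv.Perm ι, ((Fintype.card ι).factorial : ℝ)⁻¹ *
        (if permSum a σ ≤ z then 1 else 0) - cdf (gaussianReal 0 1) z| ≤ 84 * A := by
  have hn' : (2 : ℝ) ≤ Fintype.card ι := by exact_mod_cast hn
  have hN : (0 : ℝ) < (Fintype.card ι).factorial := by exact_mod_cast Nat.factorial_pos _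
  have hApos : 0 < A := by
    by_contra hA0
    have h0 : ∀ i j, a i j = 0 := fun i j =>
      abs_nonpos_iff.1 ((hA i j).trans (not_lt.1 hA0))
    simp only [h0] at hvar
    norm_num at hvar
    linarith
  set c : ℝ := 4 * (Fintype.card ι : ℝ) ^ 2 * (Fintype.card ι - 1) with hc
  have hcpos : 0 < c := by
    have : (0 : ℝ) < Fintype.card ι - 1 := by linarith
    positivity
  set N : ℝ := ((Fintype.card ι).factorial : ℝ)
  have hcard : ∑ _σ : Equiv.Perm ι, N⁻¹ = 1 := by
    rw [Finset.sum_const, Finset.card_univ, Fintype.card_perm, nsmul_eq_mul]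
    exact mul_inv_cancel₀ hN.ne'
  have hw : ∑ i, ∑ j, ∑ k, ∑ l, swapDiff a i j k l ^ 2 / c = 1 := by
    simp only [← Finset.sum_div]
    rw [sum_swapDiff_sq hrow hcol, hvar, div_self hcpos.ne']
  -- A sample point `(i, j, k, l, σ)` consists of two positions, two values and a permutation.
  have hprod : ∀ G : ι × ι × ι × ι → Equiv.Perm ι → ℝ,
      ∑ t : (ι × ι × ι × ι) × Equiv.Perm ι, G t.1 t.2 =
        ∑ i, ∑ j, ∑ k, ∑ l, ∑ σ, G (i, j, k, l) σ := fun G => by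
    simp only [Fintype.sum_prod_type]
  let p : (ι × ι × ι × ι) × Equiv.Perm ι → ℝ := fun t =>
    swapDiff a t.1.1 t.1.2.1 t.1.2.2.1 t.1.2.2.2 ^ 2 / c * N⁻¹
  have hmarg : ∀ G : Equiv.Perm ι → ℝ, ∑ t, p t * G t.2 = ∑ σ, N⁻¹ * G σ := fun G => by
    rw [hprod fun q σ => swapDiff a q.1 q.2.1 q.2.2.1 q.2.2.2 ^ 2 / c * N⁻¹ * G σ]
    simp only [mul_assoc, ← Finset.mul_sum, ← Finset.sum_mul, hw, one_mul]
  let X : (ι × ι × ι × ι) × Equiv.Perm ι → ℝ := fun t =>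
    permSum a (forceValue t.1.2.1 t.1.2.2.2 (forceValue t.1.1 t.1.2.2.1 t.2))
  let Y : (ι × ι × ι × ι) × Equiv.Perm ι → ℝ := fun t =>
    permSum a (forceValue t.1.2.1 t.1.2.2.2 (forceValue t.1.1 t.1.2.2.1 t.2) *
      Equiv.swap t.1.1 t.1.2.1)
  have hX : ∀ t, |X t - permSum a t.2| ≤ 8 * A := fun t => by
    have h1 := abs_permSum_forceValue_sub_le hA (forceValue t.1.1 t.1.2.2.1 t.2) t.1.2.1 t.1.2.2.2
    have h2 := abs_permSum_forceValue_sub_le hA t.2 t.1.1 t.1.2.2.1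
    exact (abs_sub_le _ _ _).trans (by linarith)
  have hY : ∀ t, |Y t - permSum a t.2| ≤ 12 * A := fun t => by
    have h1 := abs_permSum_mul_swap_sub_le hA
      (forceValue t.1.2.1 t.1.2.2.2 (forceValue t.1.1 t.1.2.2.1 t.2)) t.1.1 t.1.2.1
    exact (abs_sub_le _ (X t) _).trans (by linarith [hX t])
  have key := abs_sub_cdf_gaussian_le_of_zeroBias (p := p) (W := fun t => permSum a t.2)
    (X := X) (Y := Y) (δ := 12 * A) (by linarith) (fun t => by positivity)
    (by simpa [hcard] using hmarg fun _ => 1) (fun t => (hX t).trans (by linarith)) hY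
    (fun f f' hf hf' => by
      rw [hmarg fun σ => permSum a σ * f (permSum a σ), ← Finset.mul_sum,
        hprod fun q σ => p (q, σ) * ∫ u in (0 : ℝ)..1, f' (Y (q, σ) + u * (X (q, σ) - Y (q, σ)))]
      have h := sum_permSum_mul_eq_zeroBias hrow hf hf'
      rw [← hc, mul_comm c, ← div_eq_iff hcpos.ne'] at h
      rw [← h]
      simp only [p, X, Y, Finset.sum_div, Finset.mul_sum]
      refine Finset.sum_congr rfl fun i _ => Finset.sum_congr rfl fun j _ =>
        Finset.sum_congr rfl fun k _ => Finset.sum_congr rfl fun l _ =>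
        Finset.sum_congr rfl fun σ _ => ?_
      ring) z
  rw [hmarg fun σ => if permSum a σ ≤ z then 1 else 0] at key
  exact key.trans (by linarith)

end Combinatorics

/-! ### Random permutations -/

lemma abs_le_arraySupNorm {n : ℕ} (a : Fin n → Fin n → ℝ) (i j : Fin n) :
    |a i j| ≤ arraySupNorm a :=
  (le_ciSup (f := fun j => |a i j|) (Set.finite_range _).bddAbove j).trans
    (le_ciSup (f := fun i => ⨆ j, |a i j|) (Set.finite_range _).bddAbove i)

lemma cdf_map_hoeffdingStat {Ω : Type*} [MeasurableSpace Ω] (μ : Measure Ω)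
    [IsProbabilityMeasure μ] {n : ℕ} (a : Fin n → Fin n → ℝ) {π : Ω → Equiv.Perm (Fin n)}
    (hπ : IsUniformPermutation π μ) (z : ℝ) :
    cdf (μ.map (hoeffdingStat a π)) z =
      ∑ σ : Equiv.Perm (Fin n), (n.factorial : ℝ)⁻¹ * (if permSum a σ ≤ z then 1 else 0) := by
  let _ : MeasurableSpace (Equiv.Perm (Fin n)) := ⊤
  have hmeas : Measurable π := measurable_to_countable' fun σ => (hπ σ).1
  have hW : Measurable (hoeffdingStat a π) := (measurable_from_top (f := permSum a)).comp hmeas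
  have := Measure.isProbabilityMeasure_map (μ := μ) hW.aemeasurable
  have hset : hoeffdingStat a π ⁻¹' Set.Iic z =
      ⋃ σ ∈ Finset.univ.filter fun σ => permSum a σ ≤ z, π ⁻¹' {σ} := by
    ext ω
    have hω : hoeffdingStat a π ω = permSum a (π ω) := rfl
    simp [hω]
  rw [cdf_eq_real, map_measureReal_apply hW measurableSet_Iic, hset,
    measureReal_biUnion_finset ?_ fun σ _ => (hπ σ).1]
  · simp only [Measure.real, (hπ _).2, mul_ite, mul_one, mul_zero, Finset.sum_ite,
      Finset.sum_const_zero, add_zero]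
    simp
  · intro σ _ τ _ hne
    exact Set.disjoint_left.2 fun ω h1 h2 => hne (h1.symm.trans h2)

theorem mainTheorem6 {Ω : Type*} [MeasurableSpace Ω] (μ : Measure Ω) [IsProbabilityMeasure μ]
    (n : ℕ) (a : Fin n → Fin n → ℝ)
    (hrow : ∀ i, ∑ k, a i k = 0) (hcol : ∀ j, ∑ k, a k j = 0)
    (hvar : 1 / ((n : ℝ) - 1) * ∑ i, ∑ j, (a i j) ^ 2 = 1)
    (π : Ω → Equiv.Perm (Fin n)) (hπ : IsUniformPermutation π μ) :
    kolmogorovDist (μ.map (hoeffdingStat a π)) (gaussianReal 0 1) ≤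
      448 * (n : ℝ) * arraySupNorm a ^ 3 + 96 * arraySupNorm a := by
  -- The sum in `hvar` is empty for `n = 0`, and its coefficient is `1 / 0 = 0` for `n = 1`.
  have hn : 2 ≤ n := by
    by_contra h
    have : n = 0 ∨ n = 1 := by lia
    rcases this with rfl | rfl <;> simp at hvar
  have hn' : (2 : ℝ) ≤ n := by exact_mod_cast hn
  have hvar' : ∑ i, ∑ j, a i j ^ 2 = (Fintype.card (Fin n) : ℝ) - 1 := by
    have hne : (n : ℝ) - 1 ≠ 0 := by linarith
    rw [Fintype.card_fin]
    field_simp at hvar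
    exact hvar
  have hA : 0 ≤ arraySupNorm a := Real.iSup_nonneg fun i => Real.iSup_nonneg fun j => abs_nonneg _
  refine ciSup_le fun z => ?_
  have h := abs_permSum_distribution_sub_cdf_gaussian_le hrow hcol (by simpa using hn) hvar'
    (abs_le_arraySupNorm a) z
  rw [Fintype.card_fin, ← cdf_map_hoeffdingStat μ a hπ z] at h
  have h3 : 0 ≤ 448 * (n : ℝ) * arraySupNorm a ^ 3 := by positivity
  linarith
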